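/- Let $(\mathcal X,\mu)$ be a probability space and let $k:\mathcal X\times\mathcal X\to\mathbb R$ be a (symmetric) positive semi-definite kernel, jointly measurable, with $\int_{\mathcal X}k(x,x)\,\mathrm d\mu(x)<\infty$. Let $\sigma_1\ge\sigma_2\ge\cdots\ge 0$ be the eigenvalues, counted with multiplicity (and padded with zeros if there are only finitely many positive ones), of the integral operator $\mathcal K:L^2(\mu)\to L^2(\mu)$, $(\mathcal Kf)(x)=\int_{\mathcal X}k(x,y)f(y)\,\mathrm d\mu(y)$. Let $Z=(z_i)_{i=1}^\ell$ be any points of $\mathcal X$. Write $k(Z,Z)=(k(z_i,z_j))_{i,j=1}^\ell$, $k(Z,x)=(k(z_i,x))_{i=1}^\ell$, $h_\mu(x,y)=\int_{\mathcal X}k(x,t)k(t,y)\,\mathrm d\mu(t)$, $h_\mu(Z,Z)=(h_\mu(z_i,z_j))_{i,j=1}^\ell$, and let $A^+$ denote the Moore–Penrose pseudo-inverse of a matrix $A$. Let $H\in\mathbb R^{\ell\times\ell}$ be any matrix with $H^\top H=h_\mu(Z,Z)$, and let $$Hk(Z,Z)^+H^\top=V\operatorname{diag}(\kappa_1,\dots,\kappa_\ell)V^\top$$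 with $V=[v_1,\dots,v_\ell]$ orthogonal and $\kappa_1\ge\cdots\ge\kappa_\ell\ge0$. Put $f_i(x)=(H^+v_i)^\top k(Z,x)$ for $1\le i\le\ell$, and, for $0\le s\le\ell$, $$k^Z_\mu(x,y)=\sum_{i=1}^{\ell}\kappa_if_i(x)f_i(y),\qquad k^Z_{s,\mu}(x,y)=\sum_{i=1}^{s}\kappa_if_i(x)f_i(y),$$ which are the Mercer decomposition with respect to $\mu$ of the Nyström kernel $k^Z(x,y)=k(x,Z)k(Z,Z)^+k(Z,y)$, and its truncation. Then $\kappa_i\le\sigma_i$ for every $1\le i\le\ell$, the function $x\mapsto k^Z_\mu(x,x)-k^Z_{s,\mu}(x,x)$ is $\mu$-integrable, and $$\int_{\mathcal X}\bigl(k^Z_\mu(x,x)-k^Z_{s,\mu}(x,x)\bigr)\,\mathrm d\mu(x)\le\sum_{i=s+1}^{\ell}\sigma_i .$$ -/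

import Mathlib

open MeasureTheory

namespace Nystrom

/-- `B` satisfies the four Penrose equations for the real matrix `A`. -/
structure IsMoorePenrose {m n : Type*} [Fintype m] [Fintype n]
    (A : Matrix m n ℝ) (B : Matrix n m ℝ) : Prop where
  mul_mul_left : A * B * A = A
  mul_mul_right : B * A * B = B
  symm_left : (A * B).transpose = A * B
  symm_right : (B * A).transpose = B * A

theorem exists_isMoorePenrose_of_isHermitian {n : Type*} [Fintype n]
    (A : Matrix n n ℝ) (hA : A.IsHermitian) : ∃ B, IsMoorePenrose A B := by
  classical
  let U : Matrix n n ℝ := hA.eigenvectorUnitary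
  let d : n → ℝ := hA.eigenvalues
  have hU : star U * U = 1 := Unitary.coe_star_mul_self hA.eigenvectorUnitary
  have hAs : A = U * Matrix.diagonal d * star U := by
    have h := hA.spectral_theorem
    rw [Unitary.conjStarAlgAut_apply] at h
    exact h
  have key : ∀ a b : n → ℝ, (U * Matrix.diagonal a * star U) * (U * Matrix.diagonal b * star U)
      = U * Matrix.diagonal (fun i => a i * b i) * star U := by
    intro a b
    calc _ = U * Matrix.diagonal a * (star U * U) * Matrix.diagonal b * star U := by
          simp only [Matrix.mul_assoc]
      _ = _ := by
          rw [hU, Matrix.mul_one, Matrix.mul_assoc U, Matrix.diagonal_mul_diagonal]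
  have tr : ∀ a : n → ℝ, (U * Matrix.diagonal a * star U).transpose
      = U * Matrix.diagonal a * star U := by
    intro a
    simp [Matrix.star_eq_conjTranspose, Matrix.conjTranspose_eq_transpose_of_trivial,
      Matrix.transpose_mul, Matrix.mul_assoc]
  refine ⟨U * Matrix.diagonal (fun i => (d i)⁻¹) * star U, ?_⟩
  rw [hAs]
  constructor
  · rw [key, key]; congr; ext i
    by_cases h : d i = 0 <;> simp [h]
  · rw [key, key]; congr; ext i
    by_cases h : d i = 0 <;> simp [h]
  · rw [key, tr]
  · rw [key, tr]

theorem exists_isMoorePenrose {m n : Type*} [Fintype m] [Fintype n] (A : Matrix m n ℝ) :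
    ∃ B, IsMoorePenrose A B := by
  classical
  have hG : (A.transpose * A).IsHermitian := by
    rw [Matrix.IsHermitian, Matrix.conjTranspose_eq_transpose_of_trivial,
      Matrix.transpose_mul, Matrix.transpose_transpose]
  obtain ⟨P, h1, h2, h3, h4⟩ := exists_isMoorePenrose_of_isHermitian _ hG
  have hGt : (A.transpose * A).transpose = A.transpose * A := by
    rw [Matrix.transpose_mul, Matrix.transpose_transpose]
  have hA : A * P * A.transpose * A = A := by
    have h0 : (A * P * A.transpose * A - A).transpose * (A * P * A.transpose * A - A) = 0 := by
      have e : A * P * A.transpose * A - A = A * (P * (A.transpose * A) - 1) := by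
        rw [Matrix.mul_sub, Matrix.mul_one]; simp only [Matrix.mul_assoc]
      have e2 : (A.transpose * A) * (P * (A.transpose * A) - 1) = 0 := by
        rw [Matrix.mul_sub, Matrix.mul_one, ← Matrix.mul_assoc, h1, sub_self]
      rw [e, Matrix.transpose_mul, Matrix.mul_assoc, ← Matrix.mul_assoc A.transpose, e2,
        Matrix.mul_zero]
    rw [← Matrix.conjTranspose_eq_transpose_of_trivial,
      Matrix.conjTranspose_mul_self_eq_zero] at h0
    exact sub_eq_zero.mp h0
  refine ⟨P * A.transpose, ?_, ?_, ?_, ?_⟩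
  · rw [← Matrix.mul_assoc]; exact hA
  · calc P * A.transpose * A * (P * A.transpose)
        = (P * (A.transpose * A) * P) * A.transpose := by simp only [Matrix.mul_assoc]
      _ = _ := by rw [h2]
  · have hPt : A * P.transpose * A.transpose * A = A := by
      have h5 : A.transpose * A * P * (A.transpose * A) = A.transpose * A := h1
      have h0 : (A * P.transpose * A.transpose * A - A).transpose *
          (A * P.transpose * A.transpose * A - A) = 0 := by
        have e : A * P.transpose * A.transpose * A - A
            = A * (P.transpose * (A.transpose * A) - 1) := by
          rw [Matrix.mul_sub, Matrix.mul_one]; simp only [Matrix.mul_assoc]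
        have h6 : A.transpose * A * (P.transpose * (A.transpose * A)) = A.transpose * A := by
          have := congrArg Matrix.transpose h5
          rwa [Matrix.transpose_mul (A.transpose * A * P), Matrix.transpose_mul _ P, hGt] at this
        have e2 : (A.transpose * A) * (P.transpose * (A.transpose * A) - 1) = 0 := by
          rw [Matrix.mul_sub, Matrix.mul_one, h6, sub_self]
        rw [e, Matrix.transpose_mul, Matrix.mul_assoc, ← Matrix.mul_assoc A.transpose, e2,
          Matrix.mul_zero]
      rw [← Matrix.conjTranspose_eq_transpose_of_trivial,
        Matrix.conjTranspose_mul_self_eq_zero] at h0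
      exact sub_eq_zero.mp h0
    have hPt' : A.transpose * A * P * A.transpose = A.transpose := by
      have := congrArg Matrix.transpose hPt
      simpa [Matrix.transpose_mul, Matrix.mul_assoc] using this
    calc (A * (P * A.transpose)).transpose = A * P.transpose * A.transpose := by
          simp [Matrix.transpose_mul, Matrix.mul_assoc]
      _ = A * P.transpose * (A.transpose * A * P * A.transpose) := by rw [hPt']
      _ = (A * P.transpose * A.transpose * A) * P * A.transpose := by
          simp only [Matrix.mul_assoc]
      _ = A * (P * A.transpose) := by rw [hPt, Matrix.mul_assoc]
  · rw [Matrix.mul_assoc]; exact h4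

/-- The Penrose equations have at most one solution. -/
theorem IsMoorePenrose.unique {m n : Type*} [Fintype m] [Fintype n] {A : Matrix m n ℝ}
    {B C : Matrix n m ℝ} (hB : IsMoorePenrose A B) (hC : IsMoorePenrose A C) : B = C := by
  have h1 : A * B = A * C := by
    calc A * B = (A * C * A) * B := by rw [hC.mul_mul_left]
      _ = (A * C) * (A * B) := by simp only [Matrix.mul_assoc]
      _ = (A * C).transpose * (A * B).transpose := by rw [hC.symm_left, hB.symm_left]
      _ = ((A * B * A) * C).transpose := by
          rw [← Matrix.transpose_mul]; simp only [Matrix.mul_assoc]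
      _ = A * C := by rw [hB.mul_mul_left, hC.symm_left]
  have h2 : B * A = C * A := by
    calc B * A = B * (A * C * A) := by rw [hC.mul_mul_left]
      _ = (B * A) * (C * A) := by simp only [Matrix.mul_assoc]
      _ = (B * A).transpose * (C * A).transpose := by rw [hC.symm_right, hB.symm_right]
      _ = (C * (A * B * A)).transpose := by
          rw [← Matrix.transpose_mul]; simp only [Matrix.mul_assoc]
      _ = C * A := by rw [hB.mul_mul_left, hC.symm_right]
  calc B = B * A * B := hB.mul_mul_right.symm
    _ = C * A * C := by rw [h2, Matrix.mul_assoc, h1, ← Matrix.mul_assoc]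
    _ = C := hC.mul_mul_right

/-- The Moore–Penrose pseudo-inverse `A⁺`: the unique solution of the four Penrose equations. -/
noncomputable def pinv {m n : Type*} [Fintype m] [Fintype n] (A : Matrix m n ℝ) :
    Matrix n m ℝ :=
  Classical.choose (exists_isMoorePenrose A)

theorem pinv_spec {m n : Type*} [Fintype m] [Fintype n] (A : Matrix m n ℝ) :
    IsMoorePenrose A (pinv A) :=
  Classical.choose_spec (exists_isMoorePenrose A)

/-- `k` is a kernel on the probability space `(X, μ)`: symmetric positive semi-definite
(all finite Gram matrices are positive semi-definite), jointly measurable,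
and with `∫ k(x, x) dμ(x) < ∞`. -/
structure IsKernel {X : Type*} [MeasurableSpace X] (μ : Measure X) (k : X → X → ℝ) : Prop where
  posSemidef : (Matrix.of k).PosSemidef
  measurable : Measurable (Function.uncurry k)
  integrable_diag : Integrable (fun x => k x x) μ

section Kernel

variable {X : Type*} [MeasurableSpace X] {μ : Measure X} {k : X → X → ℝ}

theorem IsKernel.diag_nonneg (hk : IsKernel μ k) (x : X) : 0 ≤ k x x :=
  hk.posSemidef.diag_nonneg (i := x)

theorem IsKernel.sq_le (hk : IsKernel μ k) (x y : X) : k x y ^ 2 ≤ k x x * k y y := by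
  have h := (hk.posSemidef.submatrix ![x, y])
  have hs : k y x = k x y := by simpa using hk.posSemidef.isHermitian.apply x y
  have hd := h.det_nonneg
  rw [Matrix.det_fin_two] at hd
  change 0 ≤ k x x * k y y - k x y * k y x at hd
  rw [hs] at hd
  nlinarith

theorem IsKernel.abs_le (hk : IsKernel μ k) (x y : X) : |k x y| ≤ √(k x x) * √(k y y) := by
  rw [← Real.sqrt_mul (hk.diag_nonneg x)]
  exact Real.abs_le_sqrt (hk.sq_le x y)

theorem IsKernel.measurable_diag (hk : IsKernel μ k) : Measurable (fun x => k x x) :=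
  hk.measurable.comp (measurable_id.prodMk measurable_id)

theorem IsKernel.memLp_sqrt (hk : IsKernel μ k) : MemLp (fun x => √(k x x)) 2 μ := by
  rw [memLp_two_iff_integrable_sq hk.measurable_diag.sqrt.aestronglyMeasurable]
  simpa only [Real.sq_sqrt (hk.diag_nonneg _)] using hk.integrable_diag

theorem IsKernel.memLp_section (hk : IsKernel μ k) (x : X) : MemLp (k x) 2 μ := by
  refine MemLp.mono (hk.memLp_sqrt.const_mul √(k x x))
    (hk.measurable.comp measurable_prodMk_left).aestronglyMeasurable (ae_of_all _ fun y => ?_)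
  rw [Real.norm_eq_abs, Real.norm_of_nonneg (by positivity)]
  exact hk.abs_le x y

theorem IsKernel.integrable_mul (hk : IsKernel μ k) (x : X) (f : Lp ℝ 2 μ) :
    Integrable (fun y => k x y * f y) μ :=
  (hk.memLp_section x).integrable_mul (Lp.memLp f)

theorem IsKernel.memLp_integral [SFinite μ] (hk : IsKernel μ k) (f : Lp ℝ 2 μ) :
    MemLp (fun x => ∫ y, k x y * f y ∂μ) 2 μ := by
  have hi : Integrable (fun y => √(k y y) * |f y|) μ :=
    hk.memLp_sqrt.integrable_mul (Lp.memLp f).abs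
  refine MemLp.mono (hk.memLp_sqrt.mul_const (∫ y, √(k y y) * |f y| ∂μ)) ?_
    (ae_of_all _ fun x => ?_)
  · refine StronglyMeasurable.aestronglyMeasurable ?_
    refine StronglyMeasurable.integral_prod_right (f := fun x y => k x y * f y) ?_
    exact (hk.measurable.mul
      ((Lp.stronglyMeasurable f).measurable.comp measurable_snd)).stronglyMeasurable
  · have hn : 0 ≤ ∫ y, √(k y y) * |f y| ∂μ := integral_nonneg fun y => by positivity
    rw [Real.norm_of_nonneg (mul_nonneg (Real.sqrt_nonneg _) hn), ← integral_const_mul]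
    refine (norm_integral_le_integral_norm _).trans ?_
    refine integral_mono (hk.integrable_mul x f).norm (hi.const_mul _) fun y => ?_
    rw [norm_mul, Real.norm_eq_abs, Real.norm_eq_abs, ← mul_assoc]
    exact mul_le_mul_of_nonneg_right (hk.abs_le x y) (abs_nonneg _)

/-- The integral operator `(𝒦 f)(x) = ∫ k(x, y) f(y) dμ(y)` on `L²(μ)`. -/
noncomputable def integralOperator [SFinite μ] (hk : IsKernel μ k) :
    Module.End ℝ (Lp ℝ 2 μ) where
  toFun f := (hk.memLp_integral f).toLp (fun x => ∫ y, k x y * f y ∂μ)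
  map_add' f g := by
    rw [← MemLp.toLp_add]
    refine MemLp.toLp_congr _ _ (ae_of_all _ fun x => ?_)
    simp only [Pi.add_apply]
    rw [← integral_add (hk.integrable_mul x f) (hk.integrable_mul x g)]
    refine integral_congr_ae ?_
    filter_upwards [Lp.coeFn_add f g] with y hy
    rw [hy, Pi.add_apply, mul_add]
  map_smul' c f := by
    rw [RingHom.id_apply, ← MemLp.toLp_const_smul]
    refine MemLp.toLp_congr _ _ (ae_of_all _ fun x => ?_)
    simp only [Pi.smul_apply, smul_eq_mul]
    rw [← integral_const_mul]
    refine integral_congr_ae ?_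
    filter_upwards [Lp.coeFn_smul c f] with y hy
    rw [hy, Pi.smul_apply, smul_eq_mul]
    ring

end Kernel

/-- `σ 0 ≥ σ 1 ≥ ⋯ ≥ 0` lists the positive eigenvalues of `T`, each one as often as the dimension
of its eigenspace; if there are only finitely many, the list continues with zeros. -/
structure IsEigenvalueSequence {E : Type*} [AddCommGroup E] [Module ℝ E] (T : Module.End ℝ E)
    (σ : ℕ → ℝ) : Prop where
  antitone : Antitone σ
  nonneg : ∀ i, 0 ≤ σ i
  encard_eq : ∀ t : ℝ, 0 < t →
    {i | σ i = t}.encard = (Module.rank ℝ (Module.End.eigenspace T t)).toENat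

variable {X : Type*} {ℓ : ℕ}

/-- The matrix `h(Z, Z) = (h(z_i, z_j))_{i,j}`. -/
def gram (h : X → X → ℝ) (Z : Fin ℓ → X) : Matrix (Fin ℓ) (Fin ℓ) ℝ :=
  Matrix.of fun i j => h (Z i) (Z j)

/-- `h_μ(x, y) = ∫ k(x, t) k(t, y) dμ(t)`. -/
noncomputable def squareKernel [MeasurableSpace X] (μ : Measure X) (k : X → X → ℝ) (x y : X) : ℝ :=
  ∫ t, k x t * k t y ∂μ

/-- `H` is a factor of `h_μ(Z, Z) = Hᵀ H`, and `H k(Z, Z)⁺ Hᵀ = V diag(κ) Vᵀ` with `V` orthogonal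
and `κ_1 ≥ ⋯ ≥ κ_ℓ ≥ 0`. -/
structure IsMercerData [MeasurableSpace X] (μ : Measure X) (k : X → X → ℝ) (Z : Fin ℓ → X)
    (H V : Matrix (Fin ℓ) (Fin ℓ) ℝ) (κ : Fin ℓ → ℝ) : Prop where
  factor : H.transpose * H = gram (squareKernel μ k) Z
  orthogonal : V ∈ Matrix.orthogonalGroup (Fin ℓ) ℝ
  antitone : Antitone κ
  nonneg : ∀ i, 0 ≤ κ i
  svd : H * pinv (gram k Z) * H.transpose = V * Matrix.diagonal κ * V.transpose

/-- `f_i = (H⁺ v_i)ᵀ k(Z, ·)`, where `v_i` is the `i`-th column of `V`. -/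
noncomputable def mercerFun (k : X → X → ℝ) (Z : Fin ℓ → X) (H V : Matrix (Fin ℓ) (Fin ℓ) ℝ)
    (i : Fin ℓ) (x : X) : ℝ :=
  dotProduct ((pinv H).mulVec (V.col i)) (fun j => k (Z j) x)

/-- `k^Z_μ(x, y) = ∑_{i=1}^ℓ κ_i f_i(x) f_i(y)`. -/
noncomputable def mercerKernel (k : X → X → ℝ) (Z : Fin ℓ → X) (H V : Matrix (Fin ℓ) (Fin ℓ) ℝ)
    (κ : Fin ℓ → ℝ) (x y : X) : ℝ :=
  ∑ i, κ i * mercerFun k Z H V i x * mercerFun k Z H V i y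

/-- `k^Z_{s,μ}(x, y) = ∑_{i=1}^s κ_i f_i(x) f_i(y)`. -/
noncomputable def truncatedMercerKernel (k : X → X → ℝ) (Z : Fin ℓ → X)
    (H V : Matrix (Fin ℓ) (Fin ℓ) ℝ) (κ : Fin ℓ → ℝ) (s : ℕ) (x y : X) : ℝ :=
  ∑ i with i.val < s, κ i * mercerFun k Z H V i x * mercerFun k Z H V i y

end Nystrom

/-! Let `φ` be a feature map of `k` and `m f = ∫ f φ dμ`. Then `⟨m f, φ x⟩ = (𝒦 f)(x)` and `⟨m f, m
g⟩ = ⟨f, 𝒦 g⟩`. With `b_i = ⟨m f, φ (z_i)⟩`, the number `bᵀ k(Z,Z)⁺ b` is the squared norm of the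
projection of `m f` onto the span of the `φ (z_i)`, so it is at most `‖m f‖² = ⟨𝒦 f, f⟩`
(`dotProduct_pinv_mulVec_le`).

For `f = ∑ c_i f_i` one finds `b = Hᵀ V c`, so the left side equals `∑ κ_i c_i²`. The `f_i` with
`κ_i > 0` are orthonormal in `L²(μ)`. If `κ_i > 0`, the form of `𝒦` is therefore at least `κ_i ‖f‖²`
on the span of the Mercer functions up to index `i`, and Courant–Fischer
(`IsEigenvalueSequence.le_of_finrank_lt`) gives `κ_i ≤ σ_i`. Min-max needs `𝒦` compact, which
follows from its being Hilbert–Schmidt.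

Finally `∫ κ_i f_i² dμ = κ_i`, so the integrated error is the tail sum of the `κ_i`, bounded term by
term. -/

/-! ### Hilbert–Schmidt operators are compact -/

section HilbertSchmidt

variable {E F : Type*} [NormedAddCommGroup E] [InnerProductSpace ℝ E]
  [NormedAddCommGroup F] [NormedSpace ℝ F]

/-- An orthonormal family extended by a unit vector orthogonal to it is orthonormal. -/
theorem Orthonormal.finCons {n : ℕ} {v : Fin n → E} (hv : Orthonormal ℝ v) {x : E}
    (hx : ‖x‖ = 1) (hxv : ∀ i, inner ℝ (v i) x = 0) :
    Orthonormal ℝ (Fin.cons x v : Fin (n + 1) → E) := by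
  constructor
  · intro i
    refine Fin.cases ?_ (fun i => ?_) i
    · simpa using hx
    · simpa using hv.1 i
  · intro i j
    refine Fin.cases ?_ (fun i => ?_) i <;> refine Fin.cases ?_ (fun j => ?_) j
    · simp
    · intro _; simpa [real_inner_comm] using hxv j
    · intro _; simpa using hxv i
    · intro hij
      simpa using hv.2 (i := i) (j := j) (by simpa using hij)

variable {T : E →L[ℝ] F} {C : ℝ}

/-- A Hilbert–Schmidt operator is small on the orthogonal complement of some finite orthonormal
family. -/
theorem exists_orthonormal_norm_le_of_sum_sq_le
    (hT : ∀ (n : ℕ) (v : Fin n → E), Orthonormal ℝ v → ∑ i, ‖T (v i)‖ ^ 2 ≤ C)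
    {ε : ℝ} (hε : 0 < ε) :
    ∃ (n : ℕ) (v : Fin n → E), Orthonormal ℝ v ∧
      ∀ x, (∀ i, inner ℝ (v i) x = 0) → ‖T x‖ ≤ ε * ‖x‖ := by
  -- Otherwise unit vectors with `‖T x‖ > ε` can be added to an orthonormal family forever; `n` of
  -- them force `n ε² ≤ C`.
  by_contra! hcon
  have key : ∀ n : ℕ, ∃ v : Fin n → E, Orthonormal ℝ v ∧ ∀ i, ε < ‖T (v i)‖ := by
    intro n
    induction n with
    | zero => exact ⟨Fin.elim0, ⟨fun i => i.elim0, fun i => i.elim0⟩, fun i => i.elim0⟩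
    | succ n ih =>
      obtain ⟨v, hv, hvε⟩ := ih
      obtain ⟨x, hxv, hx⟩ := hcon n v hv
      have hx0 : 0 < ‖x‖ := by
        rw [norm_pos_iff]
        rintro rfl
        simp at hx
      refine ⟨Fin.cons (‖x‖⁻¹ • x) v, hv.finCons ?_ fun i => ?_, fun i => ?_⟩
      · rw [norm_smul, norm_inv, norm_norm, inv_mul_cancel₀ hx0.ne']
      · rw [inner_smul_right, hxv, mul_zero]
      · refine Fin.cases ?_ (fun i => ?_) i
        · rw [Fin.cons_zero, map_smul, norm_smul, norm_inv, norm_norm, ← div_eq_inv_mul,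
            lt_div_iff₀ hx0]
          exact hx
        · simpa using hvε i
  obtain ⟨n, hn⟩ := exists_nat_gt (C / ε ^ 2)
  obtain ⟨v, hv, hvε⟩ := key n
  have h1 : (n : ℝ) * ε ^ 2 ≤ ∑ i, ‖T (v i)‖ ^ 2 := by
    have := Finset.card_nsmul_le_sum Finset.univ (fun i => ‖T (v i)‖ ^ 2) (ε ^ 2)
      fun i _ => pow_le_pow_left₀ hε.le (hvε i).le 2
    simpa using this
  rw [div_lt_iff₀ (by positivity)] at hn
  exact absurd (h1.trans (hT n v hv)) (not_le.2 hn)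

/-- A Hilbert–Schmidt operator is compact. -/
theorem isCompactOperator_of_sum_sq_le [CompleteSpace F]
    (hT : ∀ (n : ℕ) (v : Fin n → E), Orthonormal ℝ v → ∑ i, ‖T (v i)‖ ^ 2 ≤ C) :
    IsCompactOperator T := by
  have hcl : IsClosed {f : E →L[ℝ] F | IsCompactOperator f} :=
    isClosed_setOfPred_isCompactOperator
  -- Compact operators are norm closed, and `T` is approximated by `T` composed with the projection
  -- onto a finite-dimensional span. Half of `ε` makes the final inequality strict.
  refine hcl.closure_subset (Metric.mem_closure_iff.2 fun ε hε => ?_)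
  obtain ⟨n, v, hv, h⟩ := exists_orthonormal_norm_le_of_sum_sq_le hT (half_pos hε)
  let S : Submodule ℝ E := Submodule.span ℝ (Set.range v)
  have : FiniteDimensional ℝ S := FiniteDimensional.span_of_finite ℝ (Set.finite_range v)
  have : ProperSpace S := FiniteDimensional.proper ℝ S
  refine ⟨(T.comp S.subtypeL).comp S.orthogonalProjectionOnto, ?_, ?_⟩
  · exact (isCompactOperator_of_locallyCompactSpace_dom
      S.orthogonalProjectionOnto).clm_comp (T.comp S.subtypeL)
  · rw [dist_eq_norm]
    refine lt_of_le_of_lt (ContinuousLinearMap.opNorm_le_bound _ (half_pos hε).le fun x => ?_)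
      (half_lt_self hε)
    have hx : x - S.orthogonalProjectionOnto x ∈ Sᗮ := S.sub_starProjection_mem_orthogonal x
    have e : (T - (T.comp S.subtypeL).comp S.orthogonalProjectionOnto) x
        = T (x - S.orthogonalProjectionOnto x) := by simp
    rw [e]
    refine (h _ fun i => ?_).trans ?_
    · exact (Submodule.mem_orthogonal _ _).1 hx _ (Submodule.subset_span ⟨i, rfl⟩)
    · refine mul_le_mul_of_nonneg_left ?_ (half_pos hε).le
      have := Sᗮ.norm_starProjection_apply_le x
      rwa [Submodule.starProjection_orthogonal_val] at this

end HilbertSchmidt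

/-- An upper bound on dimension suffices below, so independence of eigenspaces plays no role. -/
theorem Submodule.finrank_finset_sup_le {K M ι : Type*} [Field K] [AddCommGroup M] [Module K M]
    (s : Finset ι) (V : ι → Submodule K M) (hV : ∀ i ∈ s, FiniteDimensional K (V i)) :
    FiniteDimensional K (s.sup V : Submodule K M) ∧
      Module.finrank K (s.sup V : Submodule K M) ≤ ∑ i ∈ s, Module.finrank K (V i) := by
  classical
  induction s using Finset.induction_on with
  | empty =>
    rw [Finset.sup_empty]
    exact ⟨inferInstance, by simp⟩
  | insert a s ha ih =>
    obtain ⟨h1, h2⟩ := ih fun i hi => hV i (Finset.mem_insert_of_mem hi)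
    have h3 := hV a (Finset.mem_insert_self a s)
    rw [Finset.sup_insert, Finset.sum_insert ha]
    exact ⟨inferInstance,
      (Submodule.finrank_add_le_finrank_add_finrank _ _).trans (Nat.add_le_add_left h2 _)⟩

/-! ### Courant–Fischer from an eigenvalue list -/

section MinMax

variable {E : Type*} [NormedAddCommGroup E] [InnerProductSpace ℝ E]

/-- If all eigenvalues of a compact, symmetric and positive operator are at most `c`, then the
quadratic form is bounded by `c`. -/
theorem inner_map_self_le_of_hasEigenvalue_le [CompleteSpace E] {S : E →L[ℝ] E}
    (hc : IsCompactOperator S) (hs : S.IsSymmetric) (hpos : ∀ x, 0 ≤ inner ℝ (S x) x)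
    {c : ℝ} (hc0 : 0 ≤ c) (h : ∀ t, Module.End.HasEigenvalue (S : Module.End ℝ E) t → t ≤ c)
    (x : E) : inner ℝ (S x) x ≤ c * ‖x‖ ^ 2 := by
  have hn : ‖S‖ ≤ c := by
    -- The norm of a self-adjoint operator is its spectral radius, and the nonzero spectrum of a
    -- compact operator consists of eigenvalues.
    have h1 : (‖S‖₊ : ENNReal) ≤ ENNReal.ofReal c := by
      rw [← S.spectralRadius_eq_nnnorm hs.isSelfAdjoint]
      refine iSup₂_le fun t ht => ?_
      rcases eq_or_ne t 0 with rfl | ht0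
      · simp
      · have he := (hc.hasEigenvalue_iff_mem_spectrum ht0).2 ht
        have ht' : 0 ≤ t := eigenvalue_nonneg_of_nonneg (𝕜 := ℝ) he fun x => by
          simpa [real_inner_comm] using hpos x
        rw [← enorm_eq_nnnorm, Real.enorm_of_nonneg ht']
        exact ENNReal.ofReal_le_ofReal (h t he)
    rw [← enorm_eq_nnnorm, ← ofReal_norm] at h1
    exact (ENNReal.ofReal_le_ofReal_iff hc0).1 h1
  calc inner ℝ (S x) x ≤ ‖S x‖ * ‖x‖ := real_inner_le_norm _ _
    _ ≤ (c * ‖x‖) * ‖x‖ := by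
      gcongr
      exact S.le_of_opNorm_le hn x
    _ = c * ‖x‖ ^ 2 := by ring

namespace Nystrom

/-- The eigenspaces of eigenvalues larger than `σ n` have total dimension at most `n`. -/
theorem IsEigenvalueSequence.exists_finrank_le {E : Type*} [AddCommGroup E] [Module ℝ E]
    {T : Module.End ℝ E} {σ : ℕ → ℝ} (hσ : IsEigenvalueSequence T σ) (n : ℕ) :
    ∃ s : Finset ℝ, (∀ t, σ n < t → T.HasEigenvalue t → t ∈ s) ∧
      FiniteDimensional ℝ (s.sup T.eigenspace : Submodule ℝ E) ∧
      Module.finrank ℝ (s.sup T.eigenspace : Submodule ℝ E) ≤ n := by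
  classical
  -- Monotonicity places every index with value above `σ n` below `n`. Such values are positive, so
  -- the multiplicity clause applies and the fibres of `σ` over them count dimensions.
  let J : Finset ℕ := {j ∈ Finset.range n | σ n < σ j}
  have hlt : ∀ j, σ n < σ j → j ∈ J := fun j hj => by
    refine Finset.mem_filter.2 ⟨Finset.mem_range.2 ?_, hj⟩
    by_contra! hnj
    exact absurd (hσ.antitone hnj) (not_le.2 hj)
  have hfib : ∀ t, σ n < t → {i | σ i = t} = ((J.filter fun j => σ j = t : Finset ℕ) : Set ℕ) := by
    intro t ht
    ext j
    simp only [Set.mem_ofPred_eq, Finset.coe_filter]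
    exact ⟨fun hj => ⟨hlt j (hj ▸ ht), hj⟩, fun hj => hj.2⟩
  have hcard : ∀ t, σ n < t → ((J.filter fun j => σ j = t).card : ℕ∞)
      = (Module.rank ℝ (T.eigenspace t)).toENat := by
    intro t ht
    rw [← hσ.encard_eq t ((hσ.nonneg n).trans_lt ht), hfib t ht, Set.encard_coe_eq_coe_finsetCard]
  have hfin : ∀ t, σ n < t → FiniteDimensional ℝ (T.eigenspace t) ∧
      Module.finrank ℝ (T.eigenspace t) = (J.filter fun j => σ j = t).card := by
    intro t ht
    have h := hcard t ht
    have hf : FiniteDimensional ℝ (T.eigenspace t) := by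
      rw [FiniteDimensional, ← Module.rank_lt_aleph0_iff, ← Cardinal.toENat_lt_top, ← h]
      exact ENat.natCast_lt_top _
    refine ⟨hf, ?_⟩
    rw [← Module.finrank_eq_rank, Cardinal.toENat_nat] at h
    exact_mod_cast h.symm
  have hs : ∀ t ∈ J.image σ, σ n < t := by
    intro t ht
    obtain ⟨j, hj, rfl⟩ := Finset.mem_image.1 ht
    exact (Finset.mem_filter.1 hj).2
  obtain ⟨h1, h2⟩ := Submodule.finrank_finset_sup_le (J.image σ) T.eigenspace
    fun t ht => (hfin t (hs t ht)).1
  refine ⟨J.image σ, fun t ht het => ?_, h1, h2.trans ?_⟩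
  · obtain ⟨hf, hd⟩ := hfin t ht
    have : Nontrivial (T.eigenspace t) := Submodule.nontrivial_iff_ne_bot.2 het
    have h0 : 0 < Module.finrank ℝ (T.eigenspace t) := Module.finrank_pos
    rw [hd, Finset.card_pos] at h0
    obtain ⟨j, hj⟩ := h0
    rw [Finset.mem_filter] at hj
    exact Finset.mem_image.2 ⟨j, hj⟩
  · rw [Finset.sum_congr rfl fun t ht => (hfin t (hs t ht)).2,
      ← Finset.card_eq_sum_card_image]
    exact (Finset.card_filter_le _ _).trans (Finset.card_range n).le

/-- The lower half of the Courant–Fischer min-max principle for a compact, symmetric and positive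
operator. -/
theorem IsEigenvalueSequence.le_of_finrank_lt [CompleteSpace E] {T : E →L[ℝ] E}
    {σ : ℕ → ℝ} (hσ : IsEigenvalueSequence (T : Module.End ℝ E) σ)
    (hc : IsCompactOperator T) (hs : T.IsSymmetric) (hpos : ∀ x, 0 ≤ inner ℝ (T x) x)
    {n : ℕ} {c : ℝ} (W : Submodule ℝ E) [FiniteDimensional ℝ W] (hn : n < Module.finrank ℝ W)
    (hW : ∀ w ∈ W, c * ‖w‖ ^ 2 ≤ inner ℝ (T w) w) : c ≤ σ n := by
  obtain ⟨s, hmem, hfd, hfr⟩ := hσ.exists_finrank_le n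
  set U : Submodule ℝ E := s.sup (Module.End.eigenspace (T : Module.End ℝ E))
  have hUinv : ∀ u ∈ U, T u ∈ U := by
    have : U ≤ U.comap (T : Module.End ℝ E) := by
      refine Finset.sup_le fun t ht u hu => ?_
      rw [Submodule.mem_comap, Module.End.mem_eigenspace_iff.1 hu]
      exact U.smul_mem t ((Finset.le_sup ht : Module.End.eigenspace (T : Module.End ℝ E) t ≤ U) hu)
    exact fun u hu => this hu
  have hinv : ∀ x ∈ Uᗮ, (T : E →ₗ[ℝ] E) x ∈ Uᗮ := fun x hx => by
    rw [Submodule.mem_orthogonal] at hx ⊢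
    intro u hu
    have := hs u x
    exact this.symm.trans (hx _ (hUinv u hu))
  -- Since `dim U ≤ n < dim W`, the projection of `W` to `U` has a kernel.
  obtain ⟨w, hwW, hwU, hw0⟩ : ∃ w ∈ W, w ∈ Uᗮ ∧ w ≠ 0 := by
    let f : W →ₗ[ℝ] U := U.orthogonalProjectionOnto.toLinearMap ∘ₗ W.subtype
    obtain ⟨w, hw, hw0⟩ := Submodule.exists_mem_ne_zero_of_ne_bot
      (LinearMap.ker_ne_bot_of_finrank_lt (f := f) (hfr.trans_lt hn))
    refine ⟨w, w.2, ?_, by simpa using hw0⟩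
    exact Submodule.orthogonalProjectionOnto_eq_zero_iff.1 (LinearMap.mem_ker.1 hw)
  let S : Uᗮ →L[ℝ] Uᗮ := T.restrict hinv
  have hSc : IsCompactOperator S := hc.restrict' hinv
  have hSs : S.IsSymmetric := hs.restrict_invariant hinv
  have hle := inner_map_self_le_of_hasEigenvalue_le hSc hSs (fun x => hpos x) (hσ.nonneg n)
    (fun t ht => ?_) ⟨w, hwU⟩
  · have h1 : c * ‖w‖ ^ 2 ≤ σ n * ‖w‖ ^ 2 := (hW w hwW).trans hle
    have h2 : 0 < ‖w‖ ^ 2 := by positivity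
    exact le_of_mul_le_mul_right h1 h2
  -- An eigenvector in `Uᗮ` with eigenvalue above `σ n` would also lie in `U`, hence vanish.
  · by_contra! hlt
    obtain ⟨x, hx⟩ := ht.exists_hasEigenvector
    have hx1 : T (x : E) = t • (x : E) := congrArg Subtype.val hx.apply_eq_smul
    have hx0 : (x : E) ≠ 0 := by simpa using hx.2
    have hev : Module.End.HasEigenvector (T : Module.End ℝ E) t x :=
      ⟨Module.End.mem_eigenspace_iff.2 hx1, hx0⟩
    have ht : t ∈ s := hmem t hlt (Module.End.hasEigenvalue_of_hasEigenvector hev)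
    have hxU : (x : E) ∈ U :=
      (Finset.le_sup ht : Module.End.eigenspace (T : Module.End ℝ E) t ≤ U) hev.1
    exact hx0 (inner_self_eq_zero.1 ((Submodule.mem_orthogonal _ _).1 x.2 _ hxU))

end Nystrom

end MinMax

/-! ### Feature maps and mean embeddings -/

namespace Nystrom

universe u

/-- Moore–Aronszajn: a positive semi-definite kernel is the Gram kernel of a feature map with dense
span in a Hilbert space. -/
theorem exists_featureMap {X : Type u} {k : X → X → ℝ} (hk : (Matrix.of k).PosSemidef) :
    ∃ (F : Type u) (_ : NormedAddCommGroup F) (_ : InnerProductSpace ℝ F) (_ : CompleteSpace F)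
      (φ : X → F), (∀ x y, inner ℝ (φ x) (φ y) = k x y) ∧
      (Submodule.span ℝ (Set.range φ)).topologicalClosure = ⊤ := by
  -- The reproducing kernel space is built from an operator-valued kernel; scalars act as multiples
  -- of the identity of `ℝ`.
  let K : Matrix X X (ℝ →L[ℝ] ℝ) := .of fun x y => k x y • (1 : ℝ →L[ℝ] ℝ)
  have hsymm : ∀ x y, k y x = k x y := fun x y => by simpa using hk.isHermitian.apply x y
  have hK : K.PosSemidef := by
    have htfae := (RKHS.posSemidef_tfae (K := K)).out 0 2
    refine htfae.2 ⟨?_, fun v => ?_⟩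
    · ext x y
      simp [K, hsymm]
    · have h := hk.2 v
      rw [Finsupp.sum_comm] at h
      simpa [K, mul_comm, mul_left_comm, mul_assoc] using h
  have : Fact K.PosSemidef := ⟨hK⟩
  have hφ : ∀ x y, inner ℝ (RKHS.kerFun (RKHS.OfKernel K) x 1)
      (RKHS.kerFun (RKHS.OfKernel K) y 1) = k x y := by
    intro x y
    rw [← RKHS.kernel_inner, RKHS.OfKernel.kernel_ofKernel]
    simp [K, hsymm]
  refine ⟨RKHS.OfKernel K, inferInstance, inferInstance, inferInstance,
    fun x => RKHS.kerFun (RKHS.OfKernel K) x 1, hφ, ?_⟩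
  refine top_unique ((RKHS.kerFun_dense (RKHS.OfKernel K)).symm.le.trans
    (Submodule.topologicalClosure_mono (Submodule.span_le.2 ?_)))
  rintro _ ⟨x, r, rfl⟩
  have : RKHS.kerFun (RKHS.OfKernel K) x r = r • RKHS.kerFun (RKHS.OfKernel K) x 1 := by
    rw [← map_smul, smul_eq_mul, mul_one]
  rw [this]
  exact Submodule.smul_mem _ _ (Submodule.subset_span ⟨x, rfl⟩)

theorem norm_featureMap {X F : Type*} [NormedAddCommGroup F] [InnerProductSpace ℝ F]
    {k : X → X → ℝ} {φ : X → F} (hφ : ∀ x y, inner ℝ (φ x) (φ y) = k x y) (x : X) :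
    ‖φ x‖ = √(k x x) := by
  rw [← hφ, real_inner_self_eq_norm_sq, Real.sqrt_sq (norm_nonneg _)]

theorem pinv_transpose_of_isSymm {n : Type*} [Fintype n] {A : Matrix n n ℝ}
    (hA : A.transpose = A) : (pinv A).transpose = pinv A := by
  obtain ⟨h1, h2, h3, h4⟩ := pinv_spec A
  refine IsMoorePenrose.unique (A := A) ⟨?_, ?_, ?_, ?_⟩ (pinv_spec A)
  · simpa [Matrix.transpose_mul, hA, Matrix.mul_assoc] using congrArg Matrix.transpose h1
  · simpa [Matrix.transpose_mul, hA, Matrix.mul_assoc] using congrArg Matrix.transpose h2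
  · simpa [Matrix.transpose_mul, hA] using h4.symm
  · simpa [Matrix.transpose_mul, hA] using h3.symm

variable {X : Type u} [MeasurableSpace X] {μ : Measure X} {k : X → X → ℝ}

theorem IsKernel.symm (hk : IsKernel μ k) (x y : X) : k y x = k x y := by
  simpa using hk.posSemidef.isHermitian.apply x y

theorem gram_transpose (hk : IsKernel μ k) {ℓ : ℕ} (Z : Fin ℓ → X) :
    (gram k Z).transpose = gram k Z := by
  ext i j
  exact hk.symm _ _

theorem inner_eq_integral_mul (f g : Lp ℝ 2 μ) : inner ℝ f g = ∫ x, f x * g x ∂μ := by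
  rw [L2.inner_def]
  exact integral_congr_ae (ae_of_all _ fun x => by simp [mul_comm])

section FeatureMap

variable {F : Type*} [NormedAddCommGroup F] [InnerProductSpace ℝ F] {φ : X → F}

/-- No measurability of `φ` or separability of `F` is assumed: measurability holds for `g = φ y`,
passes to the span by linearity and to `F` by pointwise limits. -/
theorem IsKernel.measurable_inner_featureMap (hk : IsKernel μ k)
    (hφ : ∀ x y, inner ℝ (φ x) (φ y) = k x y)
    (hd : (Submodule.span ℝ (Set.range φ)).topologicalClosure = ⊤) (g : F) :
    Measurable fun x => inner ℝ (φ x) g := by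
  have hspan : ∀ g ∈ Submodule.span ℝ (Set.range φ), Measurable fun x => inner ℝ (φ x) g := by
    intro g hg
    induction hg using Submodule.span_induction with
    | mem g hg =>
      obtain ⟨y, rfl⟩ := hg
      simp_rw [hφ]
      exact hk.measurable.comp measurable_prodMk_right
    | zero => simp
    | add g g' _ _ h h' =>
      simp_rw [inner_add_right]
      exact h.add h'
    | smul c g _ h =>
      simp_rw [inner_smul_right]
      exact h.const_mul c
  have hg : g ∈ closure (Submodule.span ℝ (Set.range φ) : Set F) := by
    rw [← Submodule.topologicalClosure_coe, hd]
    trivial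
  obtain ⟨u, hu, hlim⟩ := mem_closure_iff_seq_limit.1 hg
  exact measurable_of_tendsto_metrizable (fun n => hspan (u n) (hu n))
    (tendsto_pi_nhds.2 fun x => tendsto_const_nhds.inner hlim)

/-- The kernel mean embedding of a function in `L²(μ)`. -/
theorem IsKernel.exists_meanEmbedding [CompleteSpace F] (hk : IsKernel μ k)
    (hφ : ∀ x y, inner ℝ (φ x) (φ y) = k x y)
    (hd : (Submodule.span ℝ (Set.range φ)).topologicalClosure = ⊤) (f : Lp ℝ 2 μ) :
    ∃ m : F, ∀ g, inner ℝ m g = ∫ x, f x * inner ℝ (φ x) g ∂μ := by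
  have hdom : Integrable (fun x => |f x| * √(k x x)) μ :=
    (Lp.memLp f).abs.integrable_mul hk.memLp_sqrt
  have hbd : ∀ g x, ‖f x * inner ℝ (φ x) g‖ ≤ |f x| * √(k x x) * ‖g‖ := by
    intro g x
    rw [norm_mul, mul_assoc, ← norm_featureMap hφ]
    exact mul_le_mul_of_nonneg_left (norm_inner_le_norm _ _) (abs_nonneg _)
  have hint : ∀ g, Integrable (fun x => f x * inner ℝ (φ x) g) μ := fun g =>
    (hdom.mul_const ‖g‖).mono' ((Lp.aestronglyMeasurable f).mul
      (hk.measurable_inner_featureMap hφ hd g).aestronglyMeasurable) (ae_of_all _ (hbd g))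
  let L : F →ₗ[ℝ] ℝ :=
    { toFun := fun g => ∫ x, f x * inner ℝ (φ x) g ∂μ
      map_add' := fun g g' => by
        simp_rw [inner_add_right, mul_add]
        exact integral_add (hint g) (hint g')
      map_smul' := fun c g => by
        simp_rw [inner_smul_right, RingHom.id_apply, smul_eq_mul, ← integral_const_mul]
        exact integral_congr_ae (ae_of_all _ fun x => by ring) }
  -- By Cauchy–Schwarz `|⟨φ x, g⟩| ≤ √k(x,x) ‖g‖`, so the functional is bounded and Riesz represents
  -- it.
  let L' : StrongDual ℝ F := L.mkContinuous (∫ x, |f x| * √(k x x) ∂μ) fun g => by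
    rw [← integral_mul_const]
    exact norm_integral_le_of_norm_le (hdom.mul_const _) (ae_of_all _ (hbd g))
  exact ⟨(InnerProductSpace.toDual ℝ F).symm L', fun g => by
    rw [InnerProductSpace.toDual_symm_apply]; rfl⟩

end FeatureMap

/-! ### The integral operator: positivity, Nyström bound, compactness -/

variable [SFinite μ]

theorem integralOperator_coeFn (hk : IsKernel μ k) (f : Lp ℝ 2 μ) :
    integralOperator hk f =ᵐ[μ] fun x => ∫ y, k x y * f y ∂μ :=
  (hk.memLp_integral f).coeFn_toLp

/-- The integral operator factors through a feature space. -/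
theorem IsKernel.exists_factorization (hk : IsKernel μ k) :
    ∃ (F : Type u) (_ : NormedAddCommGroup F) (_ : InnerProductSpace ℝ F)
      (φ : X → F) (m : Lp ℝ 2 μ → F), (∀ x y, inner ℝ (φ x) (φ y) = k x y) ∧
      (∀ f x, inner ℝ (m f) (φ x) = ∫ y, k x y * f y ∂μ) ∧
      ∀ f g, inner ℝ (m f) (m g) = inner ℝ f (integralOperator hk g) := by
  obtain ⟨F, _, _, _, φ, hφ, hd⟩ := exists_featureMap hk.posSemidef
  choose m hm using hk.exists_meanEmbedding hφ hd
  have hmφ : ∀ f x, inner ℝ (m f) (φ x) = ∫ y, k x y * f y ∂μ := by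
    intro f x
    rw [hm]
    refine integral_congr_ae (ae_of_all _ fun y => ?_)
    simp only [hφ, hk.symm x y, mul_comm]
  refine ⟨F, _, _, φ, m, hφ, hmφ, fun f g => ?_⟩
  rw [hm, inner_eq_integral_mul]
  refine integral_congr_ae ?_
  filter_upwards [integralOperator_coeFn hk g] with x hx
  rw [hx, real_inner_comm, hmφ]

theorem integralOperator_isSymmetric (hk : IsKernel μ k) : (integralOperator hk).IsSymmetric := by
  obtain ⟨F, _, _, φ, m, -, -, hm⟩ := hk.exists_factorization
  intro f g
  rw [← hm, real_inner_comm, ← hm, real_inner_comm]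

theorem integralOperator_nonneg (hk : IsKernel μ k) (f : Lp ℝ 2 μ) :
    0 ≤ inner ℝ (integralOperator hk f) f := by
  obtain ⟨F, _, _, φ, m, -, -, hm⟩ := hk.exists_factorization
  rw [real_inner_comm, ← hm]
  exact real_inner_self_nonneg

/-- The quadratic form of the integral operator dominates that of the Nyström approximation. -/
theorem dotProduct_pinv_mulVec_le (hk : IsKernel μ k) {ℓ : ℕ} (Z : Fin ℓ → X) (f : Lp ℝ 2 μ) :
    (fun i => ∫ y, k (Z i) y * f y ∂μ) ⬝ᵥ
      (pinv (gram k Z)).mulVec (fun i => ∫ y, k (Z i) y * f y ∂μ)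
      ≤ inner ℝ (integralOperator hk f) f := by
  obtain ⟨F, _, _, φ, m, hφ, hmφ, hm⟩ := hk.exists_factorization
  rw [real_inner_comm, ← hm]
  set b : Fin ℓ → ℝ := fun i => ∫ y, k (Z i) y * f y ∂μ with hb
  set a : Fin ℓ → ℝ := (pinv (gram k Z)).mulVec b with ha
  -- `w` is the projection of `m f` onto the span of the `φ (Z i)`. Only `⟨m f, w⟩ = ⟨w, w⟩` is
  -- needed; it rests on the Penrose identity `G⁺ G G⁺ = G⁺` for `G = gram k Z`.
  let w : F := ∑ i, a i • φ (Z i)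
  have h1 : inner ℝ (m f) w = b ⬝ᵥ a := by
    simp only [w, inner_sum, inner_smul_right, hmφ, dotProduct, hb, mul_comm]
  have h2 : inner ℝ w w = b ⬝ᵥ a := by
    have e : inner ℝ w w = a ⬝ᵥ (gram k Z).mulVec a := by
      simp only [w, sum_inner, inner_sum, inner_smul_left, inner_smul_right, hφ, dotProduct,
        Matrix.mulVec, gram, Matrix.of_apply, Finset.mul_sum, conj_trivial]
      exact Finset.sum_congr rfl fun i _ => Finset.sum_congr rfl fun j _ => by
        rw [hk.symm]; ring
    rw [e, ha, Matrix.mulVec_mulVec, Matrix.dotProduct_mulVec, Matrix.vecMul_mulVec,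
      ← Matrix.dotProduct_mulVec, pinv_transpose_of_isSymm (gram_transpose hk Z),
      ← Matrix.mul_assoc, (pinv_spec _).mul_mul_right]
  have h3 : 0 ≤ inner ℝ (m f - w) (m f - w) := real_inner_self_nonneg
  rw [real_inner_sub_sub_self, h1, h2] at h3
  linarith

/-- The integral operator of a kernel is Hilbert–Schmidt. -/
theorem sum_norm_integralOperator_sq_le (hk : IsKernel μ k) {n : ℕ} {v : Fin n → Lp ℝ 2 μ}
    (hv : Orthonormal ℝ v) :
    ∑ i, ‖integralOperator hk (v i)‖ ^ 2 ≤ (∫ x, k x x ∂μ) ^ 2 := by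
  -- Since `(𝒦 f)(x) = ⟨f, s x⟩` almost everywhere, Bessel's inequality can be applied for each `x`
  -- and integrated.
  let s : X → Lp ℝ 2 μ := fun x => (hk.memLp_section x).toLp
  have hs : ∀ f x, inner ℝ f (s x) = ∫ y, k x y * f y ∂μ := by
    intro f x
    rw [inner_eq_integral_mul]
    refine integral_congr_ae ?_
    filter_upwards [(hk.memLp_section x).coeFn_toLp] with y hy
    rw [hy, mul_comm]
  have hsn : ∀ x, ‖s x‖ ^ 2 ≤ k x x * ∫ y, k y y ∂μ := by
    intro x
    rw [← real_inner_self_eq_norm_sq, hs, ← integral_const_mul]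
    have e : ∀ᵐ y ∂μ, k x y * s x y = k x y ^ 2 := by
      filter_upwards [(hk.memLp_section x).coeFn_toLp] with y hy
      rw [hy, sq]
    rw [integral_congr_ae e]
    exact integral_mono (hk.memLp_section x).integrable_sq (hk.integrable_diag.const_mul _)
      (hk.sq_le x)
  have hi : ∀ i, Integrable (fun x => (inner ℝ (v i) (s x)) ^ 2) μ := fun i => by
    simp_rw [hs]
    exact (hk.memLp_integral (v i)).integrable_sq
  have hT : ∀ i, ‖integralOperator hk (v i)‖ ^ 2 = ∫ x, (inner ℝ (v i) (s x)) ^ 2 ∂μ := by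
    intro i
    rw [← real_inner_self_eq_norm_sq, inner_eq_integral_mul]
    refine integral_congr_ae ?_
    filter_upwards [integralOperator_coeFn hk (v i)] with x hx
    rw [hx, hs, sq]
  simp_rw [hT]
  rw [← integral_finsetSum _ fun i _ => hi i, sq, ← integral_mul_const]
  refine integral_mono (integrable_finsetSum _ fun i _ => hi i)
    (hk.integrable_diag.mul_const _) fun x => ?_
  refine le_trans ?_ (hsn x)
  simpa using hv.sum_inner_products_le (s x) (s := Finset.univ)

theorem integralOperator_isCompactOperator (hk : IsKernel μ k) :
    IsCompactOperator (integralOperator hk) :=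
  isCompactOperator_of_sum_sq_le
    -- Hellinger–Toeplitz: a symmetric operator on a whole Hilbert space is continuous.
    (T := ⟨integralOperator hk, (integralOperator_isSymmetric hk).continuous⟩)
    fun _ _ hv => sum_norm_integralOperator_sq_le hk hv

end Nystrom

namespace Nystrom

/-! ### Matrix identities for the Mercer coefficients -/

section Matrices

variable {n : Type*} [Fintype n] {h P H V : Matrix n n ℝ}

/-- `h H⁺ = Hᵀ` if `h = Hᵀ H`. -/
theorem factor_mul_pinv (hH : H.transpose * H = h) : h * pinv H = H.transpose := by
  obtain ⟨h1, -, h3, -⟩ := pinv_spec H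
  rw [← hH, Matrix.mul_assoc, ← h3, ← Matrix.transpose_mul, h1]

variable [DecidableEq n] {κ : n → ℝ}

/-- The coefficients of the Mercer functions diagonalize `h P h`. -/
theorem mercerCoeff_transpose_mul_mul (hH : H.transpose * H = h)
    (hV : V ∈ Matrix.orthogonalGroup n ℝ)
    (hsvd : H * P * H.transpose = V * Matrix.diagonal κ * V.transpose) :
    (h * (pinv H * V)).transpose * P * (h * (pinv H * V)) = Matrix.diagonal κ := by
  have hVV : V.transpose * V = 1 := (Matrix.mem_orthogonalGroup_iff' n ℝ).1 hV
  rw [← Matrix.mul_assoc h, factor_mul_pinv hH, Matrix.transpose_mul, Matrix.transpose_transpose]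
  calc V.transpose * H * P * (H.transpose * V)
      = V.transpose * (H * P * H.transpose) * V := by simp only [Matrix.mul_assoc]
    _ = (V.transpose * V) * Matrix.diagonal κ * (V.transpose * V) := by
      rw [hsvd]; simp only [Matrix.mul_assoc]
    _ = Matrix.diagonal κ := by rw [hVV, Matrix.one_mul, Matrix.mul_one]

/-- The Mercer functions with nonzero `κ` are orthonormal, in terms of their coefficients. -/
theorem mercerCoeff_gram_mul_diagonal (hH : H.transpose * H = h)
    (hV : V ∈ Matrix.orthogonalGroup n ℝ)
    (hsvd : H * P * H.transpose = V * Matrix.diagonal κ * V.transpose) :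
    ((pinv H * V).transpose * h * (pinv H * V)) * Matrix.diagonal κ = Matrix.diagonal κ := by
  have hVV : V.transpose * V = 1 := (Matrix.mem_orthogonalGroup_iff' n ℝ).1 hV
  obtain ⟨h1, -, h3, -⟩ := pinv_spec H
  -- The columns of `V diag(κ)` lie in the range of `H`, where `H H⁺` is the identity. For singular
  -- `H` the factor `diag(κ)` cannot be dropped.
  have e1 : V * Matrix.diagonal κ = H * P * H.transpose * V := by
    rw [hsvd, Matrix.mul_assoc, hVV, Matrix.mul_one]
  have e2 : (pinv H * V).transpose * h = V.transpose * H := by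
    have ht : h.transpose = h := by
      rw [← hH, Matrix.transpose_mul, Matrix.transpose_transpose]
    rw [← ht, ← Matrix.transpose_mul, ← Matrix.mul_assoc, factor_mul_pinv hH,
      Matrix.transpose_mul, Matrix.transpose_transpose]
  calc ((pinv H * V).transpose * h * (pinv H * V)) * Matrix.diagonal κ
      = V.transpose * H * pinv H * (V * Matrix.diagonal κ) := by
        rw [e2]; simp only [Matrix.mul_assoc]
    _ = V.transpose * (H * pinv H * H) * P * H.transpose * V := by
        rw [e1]; simp only [Matrix.mul_assoc]
    _ = V.transpose * (H * P * H.transpose * V) := by rw [h1]; simp only [Matrix.mul_assoc]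
    _ = Matrix.diagonal κ := by rw [← e1, ← Matrix.mul_assoc, hVV, Matrix.one_mul]

/-- A vector supported where `κ ≠ 0` lies in the range of `diag(κ)`, which `G` fixes. -/
theorem mulVec_eq_self_of_mul_diagonal {G : Matrix n n ℝ}
    (hG : G * Matrix.diagonal κ = Matrix.diagonal κ) {c : n → ℝ} (hc : ∀ i, κ i = 0 → c i = 0) :
    G.mulVec c = c := by
  have e : c = (Matrix.diagonal κ).mulVec fun i => c i / κ i := by
    ext i
    rw [Matrix.mulVec_diagonal]
    by_cases hi : κ i = 0
    · simp [hi, hc i hi]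
    · field_simp
  rw [e, Matrix.mulVec_mulVec, hG]

end Matrices

/-! ### Mercer functions in `L²(μ)` -/

variable {X : Type*} {k : X → X → ℝ} {ℓ : ℕ}
  {Z : Fin ℓ → X} {H V : Matrix (Fin ℓ) (Fin ℓ) ℝ} {κ : Fin ℓ → ℝ}

theorem mercerFun_eq_sum (i : Fin ℓ) (x : X) :
    mercerFun k Z H V i x = ∑ j, (pinv H * V) j i * k (Z j) x :=
  rfl

theorem mercerKernel_sub_truncatedMercerKernel (s : ℕ) (x y : X) :
    mercerKernel k Z H V κ x y - truncatedMercerKernel k Z H V κ s x y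
      = ∑ i with ¬ i.val < s, κ i * mercerFun k Z H V i x * mercerFun k Z H V i y := by
  rw [mercerKernel, truncatedMercerKernel, sub_eq_iff_eq_add', Finset.sum_filter_add_sum_filter_not]

variable [MeasurableSpace X] {μ : Measure X}

theorem memLp_mercerFun (hk : IsKernel μ k) (i : Fin ℓ) : MemLp (mercerFun k Z H V i) 2 μ := by
  simp_rw [funext (mercerFun_eq_sum i)]
  exact memLp_finsetSum _ fun j _ => (hk.memLp_section (Z j)).const_mul _

/-- `∫ k(z_j, ·) f_i dμ = (h_μ(Z, Z) H⁺ V)_{j i}`. -/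
theorem integral_section_mul_mercerFun (hk : IsKernel μ k) (i j : Fin ℓ) :
    ∫ x, k (Z j) x * mercerFun k Z H V i x ∂μ
      = (gram (squareKernel μ k) Z * (pinv H * V)) j i := by
  have hi : ∀ m ∈ Finset.univ,
      Integrable (fun x => k (Z j) x * ((pinv H * V) m i * k (Z m) x)) μ := fun m _ =>
    (hk.memLp_section (Z j)).integrable_mul ((hk.memLp_section (Z m)).const_mul _)
  simp_rw [mercerFun_eq_sum, Finset.mul_sum]
  rw [integral_finsetSum _ hi, Matrix.mul_apply]
  refine Finset.sum_congr rfl fun m _ => ?_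
  rw [gram, Matrix.of_apply, squareKernel, ← integral_mul_const]
  refine integral_congr_ae (ae_of_all _ fun x => ?_)
  simp only [hk.symm (Z m) x]
  ring

theorem integral_mercerFun_mul_mercerFun (hk : IsKernel μ k) (i j : Fin ℓ) :
    ∫ x, mercerFun k Z H V i x * mercerFun k Z H V j x ∂μ
      = ((pinv H * V).transpose * gram (squareKernel μ k) Z * (pinv H * V)) i j := by
  have e : ∀ x, mercerFun k Z H V i x * mercerFun k Z H V j x
      = ∑ m, (pinv H * V) m i * (k (Z m) x * mercerFun k Z H V j x) := by
    intro x
    rw [mercerFun_eq_sum i, Finset.sum_mul]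
    exact Finset.sum_congr rfl fun m _ => mul_assoc _ _ _
  have hi : ∀ m ∈ Finset.univ,
      Integrable (fun x => (pinv H * V) m i * (k (Z m) x * mercerFun k Z H V j x)) μ := fun m _ =>
    ((hk.memLp_section (Z m)).integrable_mul (memLp_mercerFun hk j)).const_mul _
  simp_rw [e]
  rw [integral_finsetSum _ hi, Matrix.mul_assoc, Matrix.mul_apply]
  refine Finset.sum_congr rfl fun m _ => ?_
  rw [integral_const_mul, integral_section_mul_mercerFun hk, Matrix.transpose_apply]

/-- The linear combinations of the Mercer functions as elements of `L²(μ)`. -/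
noncomputable def mercerLp (hk : IsKernel μ k) (Z : Fin ℓ → X) (H V : Matrix (Fin ℓ) (Fin ℓ) ℝ) :
    (Fin ℓ → ℝ) →ₗ[ℝ] Lp ℝ 2 μ :=
  Fintype.linearCombination ℝ fun i => (memLp_mercerFun (Z := Z) (H := H) (V := V) hk i).toLp

theorem mercerLp_apply (hk : IsKernel μ k) (c : Fin ℓ → ℝ) :
    mercerLp hk Z H V c
      = ∑ i, c i • (memLp_mercerFun (Z := Z) (H := H) (V := V) hk i).toLp :=
  Fintype.linearCombination_apply _ _ _

/-- The support condition is essential: `f_i` vanishes when `Hᵀ v_i = 0`, for instance. -/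
theorem norm_mercerLp_sq (hk : IsKernel μ k) (hκ : IsMercerData μ k Z H V κ) {c : Fin ℓ → ℝ}
    (hc : ∀ i, κ i = 0 → c i = 0) : ‖mercerLp hk Z H V c‖ ^ 2 = c ⬝ᵥ c := by
  have hin : ∀ i j, inner ℝ (memLp_mercerFun (Z := Z) (H := H) (V := V) hk i).toLp
      (memLp_mercerFun (Z := Z) (H := H) (V := V) hk j).toLp
      = ((pinv H * V).transpose * gram (squareKernel μ k) Z * (pinv H * V)) i j := by
    intro i j
    rw [← integral_mercerFun_mul_mercerFun hk, inner_eq_integral_mul]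
    refine integral_congr_ae ?_
    filter_upwards [(memLp_mercerFun (Z := Z) (H := H) (V := V) hk i).coeFn_toLp,
      (memLp_mercerFun (Z := Z) (H := H) (V := V) hk j).coeFn_toLp] with x hi hj
    rw [hi, hj]
  have hG := mulVec_eq_self_of_mul_diagonal
    (mercerCoeff_gram_mul_diagonal hκ.factor hκ.orthogonal hκ.svd) hc
  rw [← real_inner_self_eq_norm_sq, mercerLp_apply]
  refine Eq.trans ?_ (congrArg (c ⬝ᵥ ·) hG)
  simp only [sum_inner, inner_sum, inner_smul_left, inner_smul_right, hin, dotProduct,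
    Matrix.mulVec, Finset.mul_sum, conj_trivial]
  rw [Finset.sum_comm]
  exact Finset.sum_congr rfl fun i _ => Finset.sum_congr rfl fun j _ => by ring

/-- The quadratic form of the integral operator on the span of the Mercer functions. -/
theorem sum_mul_sq_le_inner_mercerLp [SFinite μ] (hk : IsKernel μ k)
    (hκ : IsMercerData μ k Z H V κ) (c : Fin ℓ → ℝ) :
    ∑ i, κ i * c i ^ 2
      ≤ inner ℝ (integralOperator hk (mercerLp hk Z H V c)) (mercerLp hk Z H V c) := by
  have hb : (fun i => ∫ y, k (Z i) y * mercerLp hk Z H V c y ∂μ)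
      = (gram (squareKernel μ k) Z * (pinv H * V)).mulVec c := by
    ext i
    have e : ∀ f : Lp ℝ 2 μ, ∫ y, k (Z i) y * f y ∂μ
        = inner ℝ (hk.memLp_section (Z i)).toLp f := by
      intro f
      rw [inner_eq_integral_mul]
      refine integral_congr_ae ?_
      filter_upwards [(hk.memLp_section (Z i)).coeFn_toLp] with y hy
      rw [hy]
    rw [e, mercerLp_apply, inner_sum]
    refine Finset.sum_congr rfl fun j _ => ?_
    rw [inner_smul_right, ← e, mul_comm]
    refine congrArg (· * c j) ?_
    refine Eq.trans ?_ (integral_section_mul_mercerFun hk j i)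
    refine integral_congr_ae ?_
    filter_upwards [(memLp_mercerFun (Z := Z) (H := H) (V := V) hk j).coeFn_toLp] with y hy
    rw [hy]
  -- With `b = h H⁺ V c`, the Nyström form `bᵀ k(Z,Z)⁺ b` becomes `cᵀ diag(κ) c`.
  have h := dotProduct_pinv_mulVec_le hk Z (mercerLp hk Z H V c)
  rw [hb, Matrix.mulVec_mulVec, Matrix.dotProduct_mulVec, Matrix.vecMul_mulVec,
    ← Matrix.dotProduct_mulVec, ← Matrix.mul_assoc,
    mercerCoeff_transpose_mul_mul hκ.factor hκ.orthogonal hκ.svd] at h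
  refine le_trans (le_of_eq ?_) h
  simp only [dotProduct, Matrix.mulVec_diagonal]
  exact Finset.sum_congr rfl fun i _ => by ring

/-- Min-max with the span of the Mercer functions of index at most `i` as trial space. Positivity of
`κ i`, the nontrivial case, makes them orthonormal. -/
theorem IsMercerData.le_eigenvalue [SFinite μ] (hk : IsKernel μ k) {σ : ℕ → ℝ}
    (hσ : IsEigenvalueSequence (integralOperator hk) σ)
    (hκ : IsMercerData μ k Z H V κ) (i : Fin ℓ) : κ i ≤ σ i := by
  rcases (hκ.nonneg i).eq_or_lt with h0 | hpos
  · exact h0 ▸ hσ.nonneg i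
  -- Coefficient vectors supported on the indices `0, …, i`: dimension `i + 1`, one more than the
  -- zero-based index of `σ i`.
  let S : Submodule ℝ (Fin ℓ → ℝ) := LinearMap.range
    (Function.ExtendByZero.linearMap ℝ (Fin.castLE (Nat.succ_le_of_lt i.2)))
  have hinj : Function.Injective (Fin.castLE (Nat.succ_le_of_lt i.2)) := Fin.castLE_injective _
  have hS : ∀ c ∈ S, ∀ j, i < j → c j = 0 := by
    rintro _ ⟨d, rfl⟩ j hj
    refine Function.extend_apply' _ _ _ ?_
    rintro ⟨a, rfl⟩
    exact absurd (Nat.lt_succ_iff.1 a.2) (not_le.2 hj)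
  have hSκ : ∀ c ∈ S, ∀ j, κ j = 0 → c j = 0 := by
    intro c hc j hj
    refine hS c hc j (lt_of_not_ge fun hji => ?_)
    exact absurd (hκ.antitone hji) (by rw [hj]; exact not_le.2 hpos)
  have hfS : Module.finrank ℝ S = i + 1 := by
    rw [LinearMap.finrank_range_of_inj, Module.finrank_fin_fun]
    intro d d' hd
    funext a
    have := congrFun hd (Fin.castLE (Nat.succ_le_of_lt i.2) a)
    simpa [hinj.extend_apply] using this
  have hfW : Module.finrank ℝ (S.map (mercerLp hk Z H V)) = i + 1 := by
    rw [← hfS, ← LinearMap.range_domRestrict, LinearMap.finrank_range_of_inj]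
    rw [← LinearMap.ker_eq_bot, LinearMap.ker_eq_bot']
    intro c hc
    have h := norm_mercerLp_sq hk hκ (hSκ c c.2)
    have hc' : mercerLp hk Z H V c = 0 := hc
    rw [hc', norm_zero, zero_pow two_ne_zero] at h
    exact Subtype.ext (dotProduct_self_eq_zero.1 h.symm)
  refine IsEigenvalueSequence.le_of_finrank_lt
    (T := ⟨integralOperator hk, (integralOperator_isSymmetric hk).continuous⟩) hσ
    (integralOperator_isCompactOperator hk) (integralOperator_isSymmetric hk)
    (integralOperator_nonneg hk) (S.map (mercerLp hk Z H V)) (hfW ▸ Nat.lt_succ_self _) ?_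
  rintro _ ⟨c, hc, rfl⟩
  rw [norm_mercerLp_sq hk hκ (hSκ c hc)]
  refine le_trans ?_ (sum_mul_sq_le_inner_mercerLp hk hκ c)
  rw [dotProduct, Finset.mul_sum]
  refine Finset.sum_le_sum fun j _ => ?_
  rw [← sq]
  rcases le_or_gt j i with hji | hij
  · exact mul_le_mul_of_nonneg_right (hκ.antitone hji) (sq_nonneg _)
  · simp [hS c hc j hij]

theorem integrable_mercerFun_sq (hk : IsKernel μ k) (i : Fin ℓ) :
    Integrable (fun x => κ i * mercerFun k Z H V i x * mercerFun k Z H V i x) μ := by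
  simp_rw [mul_assoc]
  exact ((memLp_mercerFun hk i).integrable_mul (memLp_mercerFun hk i)).const_mul _

/-- The diagonal of `G diag(κ) = diag(κ)`, with `G` the `L²` Gram matrix, covers `κ_i = 0` too,
where `f_i` need not be normalised. -/
theorem IsMercerData.integral_mercerFun_sq (hk : IsKernel μ k)
    (hκ : IsMercerData μ k Z H V κ) (i : Fin ℓ) :
    ∫ x, κ i * mercerFun k Z H V i x * mercerFun k Z H V i x ∂μ = κ i := by
  simp_rw [mul_assoc]
  rw [integral_const_mul, integral_mercerFun_mul_mercerFun hk, mul_comm]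
  have h := congrFun (congrFun
    (mercerCoeff_gram_mul_diagonal hκ.factor hκ.orthogonal hκ.svd) i) i
  rwa [Matrix.mul_diagonal, Matrix.diagonal_apply_eq] at h

end Nystrom

theorem theorem4p5 {X : Type*} [MeasurableSpace X] (μ : Measure X) [IsProbabilityMeasure μ]
    (k : X → X → ℝ) (hk : Nystrom.IsKernel μ k)
    (σ : ℕ → ℝ) (hσ : Nystrom.IsEigenvalueSequence (Nystrom.integralOperator hk) σ)
    (ℓ : ℕ) (Z : Fin ℓ → X)
    (H V : Matrix (Fin ℓ) (Fin ℓ) ℝ) (κ : Fin ℓ → ℝ) (hκ : Nystrom.IsMercerData μ k Z H V κ)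
    (s : ℕ) (hs : s ≤ ℓ) :
    (∀ i : Fin ℓ, κ i ≤ σ i) ∧
    Integrable (fun x => Nystrom.mercerKernel k Z H V κ x x
      - Nystrom.truncatedMercerKernel k Z H V κ s x x) μ ∧
    ∫ x, (Nystrom.mercerKernel k Z H V κ x x
      - Nystrom.truncatedMercerKernel k Z H V κ s x x) ∂μ
      ≤ ∑ i ∈ Finset.Ico s ℓ, σ i := by
  have hle : ∀ i : Fin ℓ, κ i ≤ σ i := hκ.le_eigenvalue hk hσ
  simp_rw [Nystrom.mercerKernel_sub_truncatedMercerKernel]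
  refine ⟨hle, integrable_finsetSum _ fun i _ => Nystrom.integrable_mercerFun_sq hk i, ?_⟩
  rw [integral_finsetSum _ fun i _ => Nystrom.integrable_mercerFun_sq hk i]
  simp_rw [hκ.integral_mercerFun_sq hk]
  refine (Finset.sum_le_sum fun i _ => hle i).trans (le_of_eq ?_)
  -- Zero-based, the tail `σ_{s+1}, …, σ_ℓ` is indexed by `s ≤ i < ℓ`.
  rw [Finset.sum_filter, Fin.sum_univ_eq_sum_range (fun i => if ¬ i < s then σ i else 0) ℓ,
    ← Finset.sum_filter]
  refine Finset.sum_congr ?_ fun _ _ => rfl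
  ext i
  simp [and_comm]
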